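/- Let $\mu$ be a positive Borel measure on $\mathbb{R}$ with infinite support and finite moments $\int |x|^m\,d\mu<\infty$ for all $m\ge 0$, and suppose that the convex hull of its support is $[\xi,\eta]$ with $\xi\in\mathbb{R}$ (where $\eta=+\infty$, i.e. the hull $[\xi,\infty)$, is allowed). Let $a\le\xi$. For a positive measure $\nu$ with infinite support and finite moments, its monic orthogonal polynomials are the unique monic polynomials $q_0,q_1,\dots$ with $\deg q_m=m$ and $\int q_m q_l\,d\nu=0$ for $m\ne l$. Denote by $p_m$, $p_m^{**}(a;\cdot)$ and $p_m^N(a;\cdot)$ the monic orthogonal polynomials of $d\mu$, of $(x-a)^2d\mu$ and of $d\mu+N\delta_a$ $(N\ge 0)$, respectively. Let $n\ge 1$. Then $p_n$, $p_n^N(a;\cdot)$ (for every $N\ge 0$) and $p_{n-1}^{**}(a;\cdot)$ have only real and simple zeros. Denote them, in increasing order, by $x_{n,1}<\dots<x_{n,n}$, by $x_{n,1}^N<\dots<x_{n,n}^N$ and by $x_{n-1,1}^{**}<\dots<x_{n-1,n-1}^{**}$, respectively. For every $N>0$, $$a<x_{n,1}^{N}<x_{n,1}<x_{n-1,1}^{**}<x_{n,2}^{N}<x_{n,2}<\cdots<x_{n-1,n-1}^{**}<x_{n,n}^{N}<x_{n,n}.$$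 Moreover, for each $k=1,\dots,n$, $x_{n,k}^N$ is a strictly decreasing function of $N\in[0,\infty)$, and, for each $k=1,\dots,n-1$, $$\lim_{N\to\infty}x_{n,1}^{N}=a,\qquad \lim_{N\to\infty}x_{n,k+1}^{N}=x_{n-1,k}^{**},$$ as well as $$\lim_{N\to\infty}N\,[x_{n,1}^{N}-a]=\frac{-p_n(a)}{B_n\,p_{n-1}^{**}(a;a)},\qquad \lim_{N\to\infty}N\,[x_{n,k+1}^{N}-x_{n-1,k}^{**}]=\frac{-p_n(x_{n-1,k}^{**})}{B_n\,(x_{n-1,k}^{**}-a)\,(p_{n-1}^{**})'(a;x_{n-1,k}^{**})},$$ where the prime is the derivative in $x$ and $B_n=K_{n-1}(a,a)=\sum_{j=0}^{n-1}p_j(a)^2\big/\int p_j^2\,d\mu$. -/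

import Mathlib

open MeasureTheory Polynomial

noncomputable section

/-- The inner product `∫ p q dμ` of two real polynomials. -/
def polyInner (μ : Measure ℝ) (p q : ℝ[X]) : ℝ :=
  ∫ x, p.eval x * q.eval x ∂μ

/-- `p` is a sequence of monic orthogonal polynomials (MOPS) with respect to `μ`. -/
def IsMOPS (μ : Measure ℝ) (p : ℕ → ℝ[X]) : Prop :=
  (∀ n, (p n).Monic ∧ (p n).natDegree = n) ∧
    ∀ m n, m ≠ n → polyInner μ (p m) (p n) = 0

/-- The monic orthogonal polynomials of `μ`, built from `1, X, X ^ 2, …` by the Gram-Schmidt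
process. By `isMOPS_orthPoly` and `IsMOPS.eq_orthPoly` this is the one and only MOPS of `μ`
whenever `μ` has finite moments and infinite support. -/
def orthPoly (μ : Measure ℝ) : ℕ → ℝ[X]
  | n => X ^ n - ∑ j : Fin n,
      C (polyInner μ (X ^ n) (orthPoly μ j) / polyInner μ (orthPoly μ j) (orthPoly μ j)) *
        orthPoly μ j
termination_by n => n
decreasing_by exact j.2

/-- The kernel polynomial `K_n(x, y) = ∑_{j ≤ n} p_j(x) p_j(y) / ‖p_j‖²` of `μ`. -/
def kernelPoly (μ : Measure ℝ) (n : ℕ) (x y : ℝ) : ℝ :=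
  ∑ j ∈ Finset.range (n + 1),
    (orthPoly μ j).eval y * (orthPoly μ j).eval x / polyInner μ (orthPoly μ j) (orthPoly μ j)

/-- The iterated Christoffel transform `(x - a)² dμ` of `μ`. -/
def iteratedChristoffel (μ : Measure ℝ) (a : ℝ) : Measure ℝ :=
  μ.withDensity fun x => ENNReal.ofReal ((x - a) ^ 2)

/-- The Uvarov transform `dμ + N δ_a` of `μ` (for a mass `N ≥ 0`). -/
def uvarov (μ : Measure ℝ) (a N : ℝ) : Measure ℝ :=
  μ + ENNReal.ofReal N • Measure.dirac a

/-- The polynomial `p` has degree exactly `n` and exactly `n` distinct real zeros (all its zeros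
are therefore real and simple), and these are `x 0 < x 1 < ⋯ < x (n - 1)`. -/
def IsOrderedZeros (n : ℕ) (p : ℝ[X]) (x : Fin n → ℝ) : Prop :=
  p.natDegree = n ∧ StrictMono x ∧ ∀ t : ℝ, p.IsRoot t ↔ ∃ k, x k = t

/-! Existence and uniqueness of the MOPS. -/

theorem integrable_eval {μ : Measure ℝ} (hmom : ∀ n : ℕ, Integrable (fun x : ℝ => |x| ^ n) μ)
    (p : ℝ[X]) : Integrable (fun x => p.eval x) μ := by
  have h : ∀ n : ℕ, Integrable (fun x : ℝ => x ^ n) μ := fun n =>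
    (hmom n).mono' (by fun_prop) (by simp)
  simp only [eval_eq_sum_range]
  exact integrable_finsetSum _ fun i _ => (h i).const_mul _

theorem polyInner_comm (μ : Measure ℝ) (p q : ℝ[X]) : polyInner μ p q = polyInner μ q p := by
  simp only [polyInner, mul_comm]

theorem polyInner_sub_left {μ : Measure ℝ}
    (hmom : ∀ n : ℕ, Integrable (fun x : ℝ => |x| ^ n) μ) (p q r : ℝ[X]) :
    polyInner μ (p - q) r = polyInner μ p r - polyInner μ q r := by
  have h := fun s : ℝ[X] => integrable_eval hmom (s * r)
  simp only [eval_mul] at h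
  simp only [polyInner, eval_sub, sub_mul]
  exact integral_sub (h p) (h q)

theorem polyInner_sum_left {μ : Measure ℝ}
    (hmom : ∀ n : ℕ, Integrable (fun x : ℝ => |x| ^ n) μ) {n : ℕ} (c : Fin n → ℝ)
    (f : Fin n → ℝ[X]) (r : ℝ[X]) :
    polyInner μ (∑ j, C (c j) * f j) r = ∑ j, c j * polyInner μ (f j) r := by
  have h := fun s : ℝ[X] => integrable_eval hmom (s * r)
  simp only [eval_mul] at h
  simp only [polyInner, eval_finsetSum, eval_mul, eval_C, Finset.sum_mul, mul_assoc]
  rw [integral_finsetSum _ fun i _ => (h (f i)).const_mul (c i)]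
  simp only [integral_const_mul]

theorem polyInner_self_ne_zero {μ : Measure ℝ}
    (hmom : ∀ n : ℕ, Integrable (fun x : ℝ => |x| ^ n) μ) (hsupp : μ.support.Infinite)
    {p : ℝ[X]} (hp : p ≠ 0) : polyInner μ p p ≠ 0 := by
  intro h0
  have hi := integrable_eval hmom (p * p)
  simp only [eval_mul] at hi
  have hae := (integral_eq_zero_iff_of_nonneg (fun x => mul_self_nonneg (p.eval x)) hi).1 h0
  have hcl : IsClosed {x : ℝ | p.eval x = 0} := isClosed_eq p.continuous continuous_const
  have hsub : μ.support ⊆ {x : ℝ | p.eval x = 0} := by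
    refine Measure.support_subset_of_isClosed hcl ?_
    filter_upwards [hae] with x hx
    simpa using hx
  refine hsupp ((p.roots.toFinset.finite_toSet).subset fun x hx => ?_)
  have : p.eval x = 0 := hsub hx
  simp [hp, this]

theorem orthPoly_eq (μ : Measure ℝ) (n : ℕ) :
    orthPoly μ n = X ^ n - ∑ j : Fin n,
      C (polyInner μ (X ^ n) (orthPoly μ j) / polyInner μ (orthPoly μ j) (orthPoly μ j)) *
        orthPoly μ j := by
  rw [orthPoly]

theorem orthPoly_monic_natDegree (μ : Measure ℝ) (n : ℕ) :
    (orthPoly μ n).Monic ∧ (orthPoly μ n).natDegree = n := by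
  induction n using Nat.strong_induction_on with
  | _ n ih =>
    have hdeg : (∑ j : Fin n,
        C (polyInner μ (X ^ n) (orthPoly μ j) / polyInner μ (orthPoly μ j) (orthPoly μ j)) *
          orthPoly μ j).degree < n := by
      refine (degree_sum_le _ _).trans_lt ((Finset.sup_lt_iff (WithBot.bot_lt_coe n)).2 ?_)
      intro j _
      rw [← smul_eq_C_mul]
      refine (degree_smul_le _ _).trans_lt ?_
      rw [degree_eq_natDegree (ih j j.2).1.ne_zero, (ih j j.2).2]
      exact Nat.cast_lt.2 j.2
    rw [orthPoly_eq]
    refine ⟨monic_X_pow_sub hdeg, natDegree_eq_of_degree_eq_some ?_⟩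
    rw [degree_sub_eq_left_of_degree_lt (by rwa [degree_X_pow]), degree_X_pow]

theorem isMOPS_orthPoly {μ : Measure ℝ}
    (hmom : ∀ n : ℕ, Integrable (fun x : ℝ => |x| ^ n) μ) (hsupp : μ.support.Infinite) :
    IsMOPS μ (orthPoly μ) := by
  have key : ∀ n i, i < n → polyInner μ (orthPoly μ n) (orthPoly μ i) = 0 := by
    intro n
    induction n using Nat.strong_induction_on with
    | _ n ih =>
      intro i hi
      rw [orthPoly_eq μ n, polyInner_sub_left hmom, polyInner_sum_left hmom,
        Finset.sum_eq_single (⟨i, hi⟩ : Fin n)]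
      · have := polyInner_self_ne_zero hmom hsupp (orthPoly_monic_natDegree μ i).1.ne_zero
        simp only
        field_simp
        simp
      · intro j _ hj
        have hne : (j : ℕ) ≠ i := fun h => hj (Fin.ext h)
        rcases lt_or_gt_of_ne hne with h | h
        · rw [polyInner_comm μ (orthPoly μ j) (orthPoly μ i), ih i hi j h, mul_zero]
        · rw [ih j j.2 i h, mul_zero]
      · simp
  refine ⟨orthPoly_monic_natDegree μ, fun m n hmn => ?_⟩
  rcases lt_or_gt_of_ne hmn with h | h
  · rw [polyInner_comm]
    exact key n m h
  · exact key m n h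

theorem IsMOPS.polyInner_eq_zero {μ : Measure ℝ}
    (hmom : ∀ n : ℕ, Integrable (fun x : ℝ => |x| ^ n) μ) {p : ℕ → ℝ[X]} (hp : IsMOPS μ p)
    (n : ℕ) : ∀ (m : ℕ) (r : ℝ[X]), r.degree < (m : WithBot ℕ) → m ≤ n → polyInner μ r (p n) = 0 := by
  intro m
  induction m with
  | zero =>
    intro r hr _
    have : r = 0 := by
      simpa [degree_lt_iff_coeff_zero, Polynomial.ext_iff] using hr
    simp [this, polyInner]
  | succ m ih =>
    intro r hr hm
    have hs : r = r - (C (r.coeff m) * p m) + C (r.coeff m) * p m := by ring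
    have hd : (r - C (r.coeff m) * p m).degree < (m : WithBot ℕ) := by
      rw [degree_lt_iff_coeff_zero]
      intro k hk
      have hlead : (p m).coeff m = 1 := by
        have := (hp.1 m).1.coeff_natDegree
        rwa [(hp.1 m).2] at this
      rcases hk.eq_or_lt with rfl | hk
      · simp [hlead]
      · have h1 : r.coeff k = 0 := coeff_eq_zero_of_degree_lt
          (hr.trans_le (by exact_mod_cast hk))
        have h2 : (p m).coeff k = 0 := coeff_eq_zero_of_natDegree_lt (by rw [(hp.1 m).2]; exact hk)
        simp [h1, h2]
    have h3 := ih _ hd (by omega)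
    rw [polyInner_sub_left hmom] at h3
    have h4 : polyInner μ (C (r.coeff m) * p m) (p n) = r.coeff m * polyInner μ (p m) (p n) := by
      simp only [polyInner, eval_mul, eval_C, mul_assoc, integral_const_mul]
    rw [h4, hp.2 m n (by omega)] at h3
    linarith

theorem IsMOPS.eq_orthPoly {μ : Measure ℝ}
    (hmom : ∀ n : ℕ, Integrable (fun x : ℝ => |x| ^ n) μ) (hsupp : μ.support.Infinite)
    {p : ℕ → ℝ[X]} (hp : IsMOPS μ p) : p = orthPoly μ := by
  funext n
  have hq := isMOPS_orthPoly hmom hsupp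
  by_contra hne
  have hd : (p n - orthPoly μ n).degree < (n : WithBot ℕ) := by
    have h1 : (p n).degree = n := by
      rw [degree_eq_natDegree (hp.1 n).1.ne_zero, (hp.1 n).2]
    have h2 : (orthPoly μ n).degree = n := by
      rw [degree_eq_natDegree (hq.1 n).1.ne_zero, (hq.1 n).2]
    refine (degree_sub_lt_left (h1.trans h2.symm) (hp.1 n).1.ne_zero ?_).trans_le h1.le
    rw [(hp.1 n).1, (hq.1 n).1]
  refine polyInner_self_ne_zero hmom hsupp (sub_ne_zero.2 hne) ?_
  have h1 := IsMOPS.polyInner_eq_zero hmom hp n n _ hd le_rfl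
  have h2 := IsMOPS.polyInner_eq_zero hmom hq n n _ hd le_rfl
  rw [polyInner_comm] at h1 h2
  rw [polyInner_sub_left hmom, h1, h2, sub_zero]

end

/-!
Write `P = p_{n+1}`, `Q = p_n^{**}`, `G = (X - a) Q` and `K = K_n(a, a)`. Everything rests on two
identities, both consequences of orthogonality and of the reproducing property of the kernel
`K_n(·, a)`:

* `G = P - (P(a) / K) K_n(·, a)` (`X_sub_C_mul_orthPoly_iteratedChristoffel`);
* `(1 + N K) p_{n+1}^N = P + N K G` (`C_mul_orthPoly_uvarov`).

The zeros `x_k` of `P` are real, simple and larger than `a`, by the usual orthogonality arguments.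
Writing `P = (X - x_k) M_k` and applying the reproducing property to `M_k`, the first identity
gives `Q(x_k) = M_k(a)² M_k(x_k) / (K ∫ M_k² dμ)`, so `Q` has the sign of `M_k(x_k) = P'(x_k)` at
`x_k` (`eval_orthPoly_iteratedChristoffel_mul_pos`). These signs alternate, so the `n` zeros of `Q`
separate the `x_k`.

Hence the zeros `z_0 = a < z_1 < ⋯ < z_n` of `G` satisfy `z_0 < x_0 < z_1 < x_1 < ⋯ < z_n < x_n`,
and the rest concerns the pencil `P + c G` with `c = N K`. For `s ∈ [z_k, x_k)` and
`t ∈ (z_k, x_k]` the values `P(s)` and `G(t)` have opposite signs (`eval_prod_mul_neg`), so by the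
intermediate value theorem a zero of `P + c G` in `(z_k, x_k]` moves to the left when `c` grows
(`exists_pencil_zero`); starting from `c = 0` this yields all the zeros, their interlacing and their
monotonicity. Finally, with `G = (X - z_k) B`, the equation `P(y) + N K (y - z_k) B(y) = 0` reads
`N (y - z_k) = -P(y) / (K B(y))`, from which both limits follow (`tendsto_pencil_zero`).
-/

open MeasureTheory Polynomial

/-! ### The bilinear form of a measure -/

theorem polyInner_mul_assoc (μ : Measure ℝ) (p q r : ℝ[X]) :
    polyInner μ (p * q) r = polyInner μ p (q * r) := by
  simp only [polyInner, eval_mul, mul_assoc]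

theorem polyInner_C_mul_left (μ : Measure ℝ) (c : ℝ) (p q : ℝ[X]) :
    polyInner μ (C c * p) q = c * polyInner μ p q := by
  simp only [polyInner, eval_mul, eval_C, mul_assoc, integral_const_mul]

theorem polyInner_add_left {μ : Measure ℝ}
    (hmom : ∀ n : ℕ, Integrable (fun x : ℝ => |x| ^ n) μ) (p q r : ℝ[X]) :
    polyInner μ (p + q) r = polyInner μ p r + polyInner μ q r := by
  have h := polyInner_sub_left hmom (p + q) q r
  rw [add_sub_cancel_right] at h
  linarith

/-- A nonzero polynomial that is nonnegative `μ`-almost everywhere has a positive integral, since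
the support of `μ` is not contained in its finite zero set. -/
theorem integral_eval_pos {μ : Measure ℝ} (hmom : ∀ n : ℕ, Integrable (fun x : ℝ => |x| ^ n) μ)
    (hsupp : μ.support.Infinite) {p : ℝ[X]} (hp : p ≠ 0) (hnn : ∀ᵐ x ∂μ, 0 ≤ p.eval x) :
    0 < ∫ x, p.eval x ∂μ := by
  refine (integral_nonneg_of_ae hnn).lt_of_ne' fun h0 => ?_
  have hae := (integral_eq_zero_iff_of_nonneg_ae hnn (integrable_eval hmom p)).1 h0
  have hsub : μ.support ⊆ {x : ℝ | p.eval x = 0} := by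
    refine Measure.support_subset_of_isClosed (isClosed_eq p.continuous continuous_const) ?_
    filter_upwards [hae] with x hx using hx
  refine hsupp (p.roots.toFinset.finite_toSet.subset fun x hx => ?_)
  have : p.eval x = 0 := hsub hx
  simp [hp, this]

theorem polyInner_pos_of_ae_nonneg {μ : Measure ℝ}
    (hmom : ∀ n : ℕ, Integrable (fun x : ℝ => |x| ^ n) μ) (hsupp : μ.support.Infinite)
    {p q : ℝ[X]} (hp : p ≠ 0) (hq : q ≠ 0) (hnn : ∀ᵐ x ∂μ, 0 ≤ p.eval x * q.eval x) :
    0 < polyInner μ p q := by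
  have h := integral_eval_pos hmom hsupp (mul_ne_zero hp hq) (by simpa using hnn)
  simpa [polyInner] using h

theorem polyInner_self_pos {μ : Measure ℝ}
    (hmom : ∀ n : ℕ, Integrable (fun x : ℝ => |x| ^ n) μ) (hsupp : μ.support.Infinite)
    {p : ℝ[X]} (hp : p ≠ 0) : 0 < polyInner μ p p :=
  polyInner_pos_of_ae_nonneg hmom hsupp hp hp (.of_forall fun _ => mul_self_nonneg _)

/-- If `∫ p² dμ` vanishes only for `p = 0`, then `μ` has infinite support: otherwise the monic
polynomial vanishing on the support would be a counterexample. -/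
theorem support_infinite_of_polyInner_self_ne_zero {μ : Measure ℝ}
    (h : ∀ p : ℝ[X], p ≠ 0 → polyInner μ p p ≠ 0) : μ.support.Infinite := by
  intro hfin
  refine h (∏ t ∈ hfin.toFinset, (X - C t))
    (Finset.prod_ne_zero_iff.2 fun t _ => X_sub_C_ne_zero t) ?_
  refine integral_eq_zero_of_ae ?_
  filter_upwards [Measure.support_mem_ae (μ := μ)] with x hx
  have : (∏ t ∈ hfin.toFinset, (X - C t)).eval x = 0 := by
    rw [eval_prod]
    exact Finset.prod_eq_zero (hfin.mem_toFinset.2 hx) (by simp)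
  simp [this]

theorem polyInner_orthPoly_eq_zero {μ : Measure ℝ}
    (hmom : ∀ n : ℕ, Integrable (fun x : ℝ => |x| ^ n) μ) (hsupp : μ.support.Infinite)
    {n : ℕ} {r : ℝ[X]} (hr : r.degree < n) : polyInner μ r (orthPoly μ n) = 0 :=
  (isMOPS_orthPoly hmom hsupp).polyInner_eq_zero hmom n n r hr le_rfl

/-- A monic polynomial of degree `n` orthogonal to all polynomials of lower degree is the `n`-th
monic orthogonal polynomial. -/
theorem eq_orthPoly_of_forall_polyInner_eq_zero {μ : Measure ℝ}
    (hmom : ∀ n : ℕ, Integrable (fun x : ℝ => |x| ^ n) μ) (hsupp : μ.support.Infinite)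
    {n : ℕ} {p : ℝ[X]} (hp : p.Monic) (hdeg : p.natDegree = n)
    (horth : ∀ r : ℝ[X], r.degree < n → polyInner μ r p = 0) : p = orthPoly μ n := by
  by_contra hne
  obtain ⟨hm, hd⟩ := orthPoly_monic_natDegree μ n
  have hlt : (p - orthPoly μ n).degree < (n : WithBot ℕ) := by
    have h1 : p.degree = n := by rw [degree_eq_natDegree hp.ne_zero, hdeg]
    have h2 : (orthPoly μ n).degree = n := by rw [degree_eq_natDegree hm.ne_zero, hd]
    exact (degree_sub_lt_left (h1.trans h2.symm) hp.ne_zero (by rw [hp, hm])).trans_le h1.le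
  refine polyInner_self_ne_zero hmom hsupp (sub_ne_zero.2 hne) ?_
  have h1 := horth _ hlt
  have h2 := polyInner_orthPoly_eq_zero hmom hsupp hlt
  rw [polyInner_comm] at h1 h2
  rw [polyInner_sub_left hmom, h1, h2, sub_zero]

/-! ### Zeros of orthogonal polynomials -/

theorem forall_eval_pos_or_neg {q : ℝ[X]} (hq : ∀ t, q.eval t ≠ 0) :
    (∀ t, 0 < q.eval t) ∨ ∀ t, q.eval t < 0 := by
  by_contra! h
  obtain ⟨⟨s, hs⟩, t, ht⟩ := h
  obtain ⟨u, hu⟩ := intermediate_value_univ s t q.continuous ⟨hs, ht⟩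
  exact hq u hu

/-- All zeros of an orthogonal polynomial are real: otherwise removing the factor without real
zeros, which has constant sign, would give a polynomial of lower degree not orthogonal to it. -/
theorem card_roots_orthPoly {μ : Measure ℝ}
    (hmom : ∀ n : ℕ, Integrable (fun x : ℝ => |x| ^ n) μ) (hsupp : μ.support.Infinite) (n : ℕ) :
    (orthPoly μ n).roots.card = n := by
  obtain ⟨hm, hd⟩ := orthPoly_monic_natDegree μ n
  obtain ⟨q, hprod, hcard, hroots⟩ := exists_prod_multiset_X_sub_C_mul (orthPoly μ n)
  set M := ((orthPoly μ n).roots.map fun a => X - C a).prod with hM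
  have hq0 : q ≠ 0 := by
    rintro rfl
    exact hm.ne_zero (by rw [← hprod, mul_zero])
  have hMm : M.Monic := monic_multiset_prod_of_monic _ _ fun a _ => monic_X_sub_C a
  have hMd : M.natDegree = (orthPoly μ n).roots.card := natDegree_multiset_prod_X_sub_C_eq_card _
  by_contra hne
  have hlt : M.degree < (n : WithBot ℕ) := by
    rw [degree_eq_natDegree hMm.ne_zero, Nat.cast_lt]
    omega
  have h0 := polyInner_orthPoly_eq_zero hmom hsupp hlt
  rw [← hprod, ← polyInner_mul_assoc] at h0
  have hev : ∀ t, q.eval t ≠ 0 := fun t ht => by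
    have : t ∈ q.roots := (mem_roots hq0).2 ht
    simp [hroots] at this
  rcases forall_eval_pos_or_neg hev with h | h
  · refine (polyInner_pos_of_ae_nonneg hmom hsupp (mul_ne_zero hMm.ne_zero hMm.ne_zero) hq0
      (.of_forall fun x => ?_)).ne' h0
    rw [eval_mul]
    exact mul_nonneg (mul_self_nonneg _) (h x).le
  · refine (polyInner_pos_of_ae_nonneg hmom hsupp (mul_ne_zero hMm.ne_zero hMm.ne_zero)
      (neg_ne_zero.2 hq0) (.of_forall fun x => ?_)).ne' ?_
    · rw [eval_mul, eval_neg]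
      exact mul_nonneg (mul_self_nonneg _) (neg_nonneg.2 (h x).le)
    · rw [polyInner_comm, ← neg_one_mul, ← C_1, ← C_neg, polyInner_C_mul_left, polyInner_comm, h0,
        mul_zero]

theorem degree_lt_of_orthPoly_eq_mul {μ : Measure ℝ} {n : ℕ} {s r : ℝ[X]} (hs : s.Monic)
    (hs0 : 0 < s.natDegree) (h : orthPoly μ n = s * r) : r.Monic ∧ r.degree < n := by
  obtain ⟨hm, hd⟩ := orthPoly_monic_natDegree μ n
  rw [h] at hm hd
  have hr := hs.of_mul_monic_left hm
  refine ⟨hr, ?_⟩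
  rw [hs.natDegree_mul hr] at hd
  rw [degree_eq_natDegree hr.ne_zero, Nat.cast_lt]
  omega

theorem nodup_roots_orthPoly {μ : Measure ℝ}
    (hmom : ∀ n : ℕ, Integrable (fun x : ℝ => |x| ^ n) μ) (hsupp : μ.support.Infinite) (n : ℕ) :
    (orthPoly μ n).roots.Nodup := by
  rw [Multiset.nodup_iff_count_le_one]
  intro c
  rw [count_roots]
  by_contra! hlt
  obtain ⟨r, hr⟩ := (le_rootMultiplicity_iff (orthPoly_monic_natDegree μ n).1.ne_zero).1 hlt
  have hs : ((X - C c) ^ 2).Monic := (monic_X_sub_C c).pow 2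
  obtain ⟨hrm, hrd⟩ := degree_lt_of_orthPoly_eq_mul hs
    (by rw [natDegree_pow, natDegree_X_sub_C]; norm_num) hr
  have h0 := polyInner_orthPoly_eq_zero hmom hsupp hrd
  refine (polyInner_pos_of_ae_nonneg hmom hsupp hrm.ne_zero
    (orthPoly_monic_natDegree μ n).1.ne_zero (.of_forall fun x => ?_)).ne' h0
  rw [hr]
  simp only [eval_mul, eval_pow, eval_sub, eval_X, eval_C]
  nlinarith [sq_nonneg ((x - c) * r.eval x)]

/-- If `μ` is carried by `[a, ∞)`, then the zeros of its orthogonal polynomials lie in `(a, ∞)`,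
even if `μ` has an atom at `a`. -/
theorem lt_of_isRoot_orthPoly {μ : Measure ℝ}
    (hmom : ∀ n : ℕ, Integrable (fun x : ℝ => |x| ^ n) μ) (hsupp : μ.support.Infinite)
    {a : ℝ} (ha : ∀ᵐ x ∂μ, a ≤ x) {n : ℕ} {c : ℝ} (hc : (orthPoly μ n).IsRoot c) : a < c := by
  by_contra! hca
  obtain ⟨r, hr⟩ := dvd_iff_isRoot.2 hc
  obtain ⟨hrm, hrd⟩ := degree_lt_of_orthPoly_eq_mul (monic_X_sub_C c) (by simp) hr
  refine (polyInner_pos_of_ae_nonneg hmom hsupp hrm.ne_zero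
    (orthPoly_monic_natDegree μ n).1.ne_zero ?_).ne' (polyInner_orthPoly_eq_zero hmom hsupp hrd)
  filter_upwards [ha] with x hx
  rw [hr]
  simp only [eval_mul, eval_sub, eval_X, eval_C]
  nlinarith [mul_nonneg (sub_nonneg.2 (hca.trans hx)) (mul_self_nonneg (r.eval x))]

theorem Polynomial.Monic.eq_prod_X_sub_C {m : ℕ} {p : ℝ[X]} (hp : p.Monic) (hd : p.natDegree = m)
    {t : Fin m → ℝ} (ht : Function.Injective t) (h0 : ∀ k, p.eval (t k) = 0) :
    p = ∏ k, (X - C (t k)) := by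
  have hprod : (∏ k, (X - C (t k))).Monic := monic_prod_of_monic _ _ fun k _ => monic_X_sub_C _
  have hpd : (∏ k, (X - C (t k))).natDegree = m := by
    simp [natDegree_prod_of_monic _ _ fun k _ => monic_X_sub_C (t k)]
  refine eq_of_degree_sub_lt_of_eval_finset_eq (Finset.univ.image t) ?_ ?_
  · rw [Finset.card_image_of_injective _ ht, Finset.card_univ, Fintype.card_fin]
    have h1 : p.degree = m := by rw [degree_eq_natDegree hp.ne_zero, hd]
    have h2 : (∏ k, (X - C (t k))).degree = (m : WithBot ℕ) := by rw [degree_eq_natDegree hprod.ne_zero, hpd]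
    exact (degree_sub_lt_left (h1.trans h2.symm) hp.ne_zero (by rw [hp, hprod])).trans_le h1.le
  · simp only [Finset.mem_image, Finset.mem_univ, true_and, forall_exists_index,
      forall_apply_eq_imp_iff]
    intro k
    rw [h0, eval_prod, Finset.prod_eq_zero (Finset.mem_univ k) (by simp)]

theorem isOrderedZeros_of_monic {m : ℕ} {p : ℝ[X]} (hp : p.Monic) (hd : p.natDegree = m)
    {t : Fin m → ℝ} (ht : StrictMono t) (h0 : ∀ k, p.eval (t k) = 0) : IsOrderedZeros m p t := by
  refine ⟨hd, ht, fun s => ?_⟩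
  rw [IsRoot, hp.eq_prod_X_sub_C hd ht.injective h0, eval_prod, Finset.prod_eq_zero_iff]
  simp [sub_eq_zero, eq_comm]

theorem exists_isOrderedZeros_orthPoly {μ : Measure ℝ}
    (hmom : ∀ n : ℕ, Integrable (fun x : ℝ => |x| ^ n) μ) (hsupp : μ.support.Infinite) (n : ℕ) :
    ∃ x, IsOrderedZeros n (orthPoly μ n) x := by
  obtain ⟨hm, hd⟩ := orthPoly_monic_natDegree μ n
  have hcard : (orthPoly μ n).roots.toFinset.card = n := by
    rw [Multiset.toFinset_card_of_nodup (nodup_roots_orthPoly hmom hsupp n),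
      card_roots_orthPoly hmom hsupp n]
  refine ⟨(orthPoly μ n).roots.toFinset.orderEmbOfFin hcard,
    isOrderedZeros_of_monic hm hd (OrderEmbedding.strictMono _) fun k => ?_⟩
  have := Finset.orderEmbOfFin_mem _ hcard k
  rw [Multiset.mem_toFinset] at this
  exact isRoot_of_mem_roots this

/-! ### The kernel polynomial -/

/-- The kernel `K_{n-1}(x, a) = ∑_{j < n} p_j(a) p_j(x) / ‖p_j‖²` as a polynomial in `x`. The sum
has `n` terms, so the polynomial has degree less than `n`; for `n = 0` it is `0`. -/
noncomputable def kernelPolynomial (μ : Measure ℝ) (a : ℝ) (n : ℕ) : ℝ[X] :=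
  ∑ j ∈ Finset.range n,
    C ((orthPoly μ j).eval a / polyInner μ (orthPoly μ j) (orthPoly μ j)) * orthPoly μ j

theorem eval_kernelPolynomial (μ : Measure ℝ) (a : ℝ) (n : ℕ) (x : ℝ) :
    (kernelPolynomial μ a (n + 1)).eval x = kernelPoly μ n x a := by
  simp only [kernelPolynomial, kernelPoly, eval_finsetSum, eval_mul, eval_C]
  exact Finset.sum_congr rfl fun j _ => by ring

theorem degree_kernelPolynomial_lt (μ : Measure ℝ) (a : ℝ) (n : ℕ) :
    (kernelPolynomial μ a n).degree < n := by
  refine (degree_sum_le _ _).trans_lt ((Finset.sup_lt_iff (WithBot.bot_lt_coe n)).2 fun j hj => ?_)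
  rw [← smul_eq_C_mul]
  refine (degree_smul_le _ _).trans_lt ?_
  obtain ⟨hm, hd⟩ := orthPoly_monic_natDegree μ j
  rw [degree_eq_natDegree hm.ne_zero, hd]
  exact Nat.cast_lt.2 (Finset.mem_range.1 hj)

/-- The reproducing property `∫ K_{n-1}(x, a) r(x) dμ(x) = r(a)` for `deg r < n`. -/
theorem polyInner_kernelPolynomial {μ : Measure ℝ}
    (hmom : ∀ n : ℕ, Integrable (fun x : ℝ => |x| ^ n) μ) (hsupp : μ.support.Infinite) (a : ℝ)
    {n : ℕ} {r : ℝ[X]} (hr : r.degree < n) :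
    polyInner μ (kernelPolynomial μ a n) r = r.eval a := by
  induction n generalizing r with
  | zero =>
    have : r = 0 := by simpa [degree_lt_iff_coeff_zero, Polynomial.ext_iff] using hr
    simp [this, polyInner]
  | succ n ih =>
    obtain ⟨hm, hd⟩ := orthPoly_monic_natDegree μ n
    set s := r - C (r.coeff n) * orthPoly μ n with hs
    have hrs : r = s + C (r.coeff n) * orthPoly μ n := by rw [hs, sub_add_cancel]
    have hsd : s.degree < (n : WithBot ℕ) := by
      rw [degree_lt_iff_coeff_zero]
      intro k hk
      have hlead : (orthPoly μ n).coeff n = 1 := by simpa [hd] using hm.coeff_natDegree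
      rcases hk.eq_or_lt with rfl | hk
      · simp [hs, hlead]
      · have h1 : r.coeff k = 0 :=
          coeff_eq_zero_of_degree_lt (hr.trans_le (by exact_mod_cast hk))
        have h2 : (orthPoly μ n).coeff k = 0 :=
          coeff_eq_zero_of_natDegree_lt (by rw [hd]; exact hk)
        simp [hs, h1, h2]
    have hk : kernelPolynomial μ a (n + 1) = kernelPolynomial μ a n +
        C ((orthPoly μ n).eval a / polyInner μ (orthPoly μ n) (orthPoly μ n)) * orthPoly μ n := by
      rw [kernelPolynomial, Finset.sum_range_succ, ← kernelPolynomial]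
    have h1 := polyInner_orthPoly_eq_zero hmom hsupp hsd
    have h2 := polyInner_orthPoly_eq_zero hmom hsupp (degree_kernelPolynomial_lt μ a n)
    have h3 := polyInner_self_ne_zero hmom hsupp hm.ne_zero
    have h4 : polyInner μ (kernelPolynomial μ a (n + 1)) s = s.eval a := by
      rw [hk, polyInner_add_left hmom, ih hsd, polyInner_C_mul_left,
        polyInner_comm μ _ s, h1, mul_zero, add_zero]
    have h5 : polyInner μ (kernelPolynomial μ a (n + 1)) (orthPoly μ n) = (orthPoly μ n).eval a := by
      rw [hk, polyInner_add_left hmom, h2, polyInner_C_mul_left, div_mul_cancel₀ _ h3, zero_add]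
    rw [hrs, polyInner_comm, polyInner_add_left hmom, polyInner_C_mul_left, polyInner_comm, h4,
      polyInner_comm μ (orthPoly μ n), h5]
    simp

theorem kernelPoly_self_pos {μ : Measure ℝ}
    (hmom : ∀ n : ℕ, Integrable (fun x : ℝ => |x| ^ n) μ) (hsupp : μ.support.Infinite) (n : ℕ)
    (a : ℝ) : 0 < kernelPoly μ n a a := by
  have hne : kernelPolynomial μ a (n + 1) ≠ 0 := fun h => by
    have h1 := polyInner_kernelPolynomial hmom hsupp a (n := n + 1) (r := 1)
      (by rw [degree_one]; exact_mod_cast n.succ_pos)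
    simp [h, polyInner] at h1
  rw [← eval_kernelPolynomial,
    ← polyInner_kernelPolynomial hmom hsupp a (degree_kernelPolynomial_lt μ a (n + 1))]
  exact polyInner_self_pos hmom hsupp hne

/-! ### The Christoffel and Uvarov transforms -/

theorem integrable_iteratedChristoffel_iff {μ : Measure ℝ} {a : ℝ} {f : ℝ → ℝ} :
    Integrable f (iteratedChristoffel μ a) ↔ Integrable (fun x => (x - a) ^ 2 * f x) μ := by
  rw [iteratedChristoffel, integrable_withDensity_iff_integrable_smul' (by fun_prop) (by simp)]
  simp [ENNReal.toReal_ofReal, sq_nonneg]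

theorem polyInner_iteratedChristoffel (μ : Measure ℝ) (a : ℝ) (p q : ℝ[X]) :
    polyInner (iteratedChristoffel μ a) p q = polyInner μ ((X - C a) * p) ((X - C a) * q) := by
  rw [polyInner, iteratedChristoffel,
    integral_withDensity_eq_integral_toReal_smul (by fun_prop) (by simp), polyInner]
  congr 1 with x
  rw [ENNReal.toReal_ofReal (sq_nonneg _)]
  simp only [smul_eq_mul, eval_mul, eval_sub, eval_X, eval_C]
  ring

theorem integrable_pow_iteratedChristoffel {μ : Measure ℝ}
    (hmom : ∀ n : ℕ, Integrable (fun x : ℝ => |x| ^ n) μ) (a : ℝ) (n : ℕ) :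
    Integrable (fun x : ℝ => |x| ^ n) (iteratedChristoffel μ a) := by
  rw [integrable_iteratedChristoffel_iff]
  have h := integrable_eval hmom ((X - C a) ^ 2 * X ^ n)
  refine h.norm.congr (.of_forall fun x => ?_)
  simp

theorem support_iteratedChristoffel_infinite {μ : Measure ℝ}
    (hmom : ∀ n : ℕ, Integrable (fun x : ℝ => |x| ^ n) μ) (hsupp : μ.support.Infinite) (a : ℝ) :
    (iteratedChristoffel μ a).support.Infinite :=
  support_infinite_of_polyInner_self_ne_zero fun p hp => by
    rw [polyInner_iteratedChristoffel]
    exact polyInner_self_ne_zero hmom hsupp (mul_ne_zero (X_sub_C_ne_zero a) hp)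

theorem integrable_uvarov {μ : Measure ℝ} {f : ℝ → ℝ} (hf : Integrable f μ) (a N : ℝ) :
    Integrable f (uvarov μ a N) :=
  hf.add_measure ((integrable_dirac (by simp)).smul_measure (by simp))

theorem polyInner_uvarov {μ : Measure ℝ} (hmom : ∀ n : ℕ, Integrable (fun x : ℝ => |x| ^ n) μ)
    (a : ℝ) {N : ℝ} (hN : 0 ≤ N) (p q : ℝ[X]) :
    polyInner (uvarov μ a N) p q = polyInner μ p q + N * (p.eval a * q.eval a) := by
  have h := integrable_eval hmom (p * q)
  simp only [eval_mul] at h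
  rw [polyInner, uvarov, integral_add_measure h
    ((integrable_dirac enorm_lt_top).smul_measure (by simp)), integral_smul_measure, integral_dirac,
    ENNReal.toReal_ofReal hN, polyInner, smul_eq_mul]

theorem support_uvarov_infinite {μ : Measure ℝ} (hsupp : μ.support.Infinite) (a N : ℝ) :
    (uvarov μ a N).support.Infinite :=
  hsupp.mono (Measure.support_mono (Measure.le_add_right le_rfl))

/-- The kernel formula for the Christoffel transform:
`(x - a) p_n^{**}(x) = p_{n+1}(x) - p_{n+1}(a) K_n(x, a) / K_n(a, a)`. -/
theorem X_sub_C_mul_orthPoly_iteratedChristoffel {μ : Measure ℝ}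
    (hmom : ∀ n : ℕ, Integrable (fun x : ℝ => |x| ^ n) μ) (hsupp : μ.support.Infinite)
    (a : ℝ) (n : ℕ) :
    (X - C a) * orthPoly (iteratedChristoffel μ a) n = orthPoly μ (n + 1) -
      C ((orthPoly μ (n + 1)).eval a / kernelPoly μ n a a) * kernelPolynomial μ a (n + 1) := by
  obtain ⟨hm, hd⟩ := orthPoly_monic_natDegree μ (n + 1)
  set P := orthPoly μ (n + 1)
  set k := kernelPolynomial μ a (n + 1)
  set c := P.eval a / kernelPoly μ n a a with hc
  have hK := kernelPoly_self_pos hmom hsupp n a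
  have hPd : P.degree = (n + 1 : ℕ) := by rw [degree_eq_natDegree hm.ne_zero, hd]
  have hkd : (C c * k).degree < P.degree := by
    rw [hPd, ← smul_eq_C_mul]
    exact (degree_smul_le _ _).trans_lt (degree_kernelPolynomial_lt μ a (n + 1))
  have hTm : (P - C c * k).Monic := hm.sub_of_left hkd
  have hTd : (P - C c * k).natDegree = n + 1 :=
    natDegree_eq_of_degree_eq_some (by rw [degree_sub_eq_left_of_degree_lt hkd, hPd])
  have hroot : (P - C c * k).IsRoot a := by
    simp only [IsRoot, eval_sub, eval_mul, eval_C]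
    rw [eval_kernelPolynomial, hc, div_mul_cancel₀ _ hK.ne', sub_self]
  obtain ⟨S, hS⟩ := dvd_iff_isRoot.2 hroot
  have hSm : S.Monic := (monic_X_sub_C a).of_mul_monic_left (hS ▸ hTm)
  have hSd : S.natDegree = n := by
    rw [hS, (monic_X_sub_C a).natDegree_mul hSm, natDegree_X_sub_C] at hTd
    omega
  have hSQ : S = orthPoly (iteratedChristoffel μ a) n := by
    refine eq_orthPoly_of_forall_polyInner_eq_zero (integrable_pow_iteratedChristoffel hmom a)
      (support_iteratedChristoffel_infinite hmom hsupp a) hSm hSd fun r hr => ?_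
    have hrd : ((X - C a) * r).degree < ((n + 1 : ℕ) : WithBot ℕ) := by
      by_cases hr0 : r = 0
      · simp only [hr0, mul_zero, degree_zero]
        exact WithBot.bot_lt_coe _
      · rw [degree_eq_natDegree hr0, Nat.cast_lt] at hr
        rw [degree_mul, degree_X_sub_C, degree_eq_natDegree hr0]
        exact_mod_cast (by omega : 1 + r.natDegree < n + 1)
    rw [polyInner_iteratedChristoffel, ← hS, polyInner_comm, polyInner_sub_left hmom,
      polyInner_C_mul_left, polyInner_kernelPolynomial hmom hsupp a hrd, polyInner_comm,
      polyInner_orthPoly_eq_zero hmom hsupp hrd]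
    simp
  rw [← hSQ, hS]

/-- The connection formula `(1 + N K) p_{n+1}^N(x) = p_{n+1}(x) + N K (x - a) p_n^{**}(x)`, where
`K = K_n(a, a)`. -/
theorem C_mul_orthPoly_uvarov {μ : Measure ℝ}
    (hmom : ∀ n : ℕ, Integrable (fun x : ℝ => |x| ^ n) μ) (hsupp : μ.support.Infinite)
    (a : ℝ) (n : ℕ) {N : ℝ} (hN : 0 ≤ N) :
    C (1 + N * kernelPoly μ n a a) * orthPoly (uvarov μ a N) (n + 1) = orthPoly μ (n + 1) +
      C (N * kernelPoly μ n a a) * ((X - C a) * orthPoly (iteratedChristoffel μ a) n) := by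
  obtain ⟨hm, hd⟩ := orthPoly_monic_natDegree μ (n + 1)
  have hG := X_sub_C_mul_orthPoly_iteratedChristoffel hmom hsupp a n
  have hGa : ((X - C a) * orthPoly (iteratedChristoffel μ a) n).eval a = 0 := by simp
  set P := orthPoly μ (n + 1)
  set k := kernelPolynomial μ a (n + 1)
  set G := (X - C a) * orthPoly (iteratedChristoffel μ a) n
  set K := kernelPoly μ n a a
  have hK : 0 < K := kernelPoly_self_pos hmom hsupp n a
  have hpos : 0 < 1 + N * K := by positivity
  have hPd : P.degree = (n + 1 : ℕ) := by rw [degree_eq_natDegree hm.ne_zero, hd]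
  -- The monic normalization of the right-hand side, as a perturbation of `P` of lower degree.
  set d := N * P.eval a / (1 + N * K) with hdd
  have hR : C (1 + N * K) * (P - C d * k) = P + C (N * K) * G := by
    have h1 : C (1 + N * K) * C d = C (N * K) * C (P.eval a / K) := by
      rw [← C_mul, ← C_mul, hdd]
      congr 1
      field_simp
    rw [hG, mul_sub, mul_sub, ← mul_assoc, h1, C_add, C_1]
    ring
  have hkd : (C d * k).degree < P.degree := by
    rw [hPd, ← smul_eq_C_mul]
    exact (degree_smul_le _ _).trans_lt (degree_kernelPolynomial_lt μ a (n + 1))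
  have hTm : (P - C d * k).Monic := hm.sub_of_left hkd
  have hTd : (P - C d * k).natDegree = n + 1 :=
    natDegree_eq_of_degree_eq_some (by rw [degree_sub_eq_left_of_degree_lt hkd, hPd])
  rw [← hR, ← eq_orthPoly_of_forall_polyInner_eq_zero
    (fun m => integrable_uvarov (hmom m) a N) (support_uvarov_infinite hsupp a N) hTm hTd]
  intro r hr
  rw [polyInner_uvarov hmom a hN, polyInner_comm, polyInner_sub_left hmom, polyInner_C_mul_left,
    polyInner_kernelPolynomial hmom hsupp a hr, polyInner_comm,
    polyInner_orthPoly_eq_zero hmom hsupp hr]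
  have hka : k.eval a = K := eval_kernelPolynomial μ a n a
  simp only [eval_sub, eval_mul, eval_C, hka, hdd]
  field_simp
  ring

/-! ### Interlacing of the zeros of `p_{n+1}` and `p_n^{**}` -/

theorem Polynomial.exists_mem_Ioo_eval_eq_zero {p : ℝ[X]} {s t : ℝ} (hst : s < t)
    (h : p.eval s * p.eval t < 0) : ∃ u ∈ Set.Ioo s t, p.eval u = 0 := by
  rcases mul_neg_iff.1 h with ⟨h1, h2⟩ | ⟨h1, h2⟩
  · exact intermediate_value_Ioo' hst.le p.continuous.continuousOn ⟨h2, h1⟩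
  · exact intermediate_value_Ioo hst.le p.continuous.continuousOn ⟨h1, h2⟩

/-- The product `∏_{j ≠ k} (X - x_j)`. -/
noncomputable def prodErase {m : ℕ} (x : Fin m → ℝ) (k : Fin m) : ℝ[X] :=
  ∏ j ∈ Finset.univ.erase k, (X - C (x j))

theorem X_sub_C_mul_prodErase {m : ℕ} (x : Fin m → ℝ) (k : Fin m) :
    (X - C (x k)) * prodErase x k = ∏ j, (X - C (x j)) :=
  Finset.mul_prod_erase _ (fun j => X - C (x j)) (Finset.mem_univ k)

theorem eval_prodErase {m : ℕ} (x : Fin m → ℝ) (k : Fin m) (t : ℝ) :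
    (prodErase x k).eval t = ∏ j ∈ Finset.univ.erase k, (t - x j) := by
  simp [prodErase, eval_prod]

theorem eval_prodErase_self_ne_zero {m : ℕ} {x : Fin m → ℝ} (hx : StrictMono x) (k : Fin m) :
    (prodErase x k).eval (x k) ≠ 0 := by
  rw [eval_prodErase, Finset.prod_ne_zero_iff]
  intro j hj
  exact sub_ne_zero.2 (hx.injective.ne (Finset.ne_of_mem_erase hj).symm)

/-- The derivative of `∏ (X - x_j)` has opposite signs at consecutive zeros. -/
theorem eval_prodErase_castSucc_mul_succ_neg {n : ℕ} {x : Fin (n + 1) → ℝ} (hx : StrictMono x)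
    (k : Fin n) :
    (prodErase x k.castSucc).eval (x k.castSucc) * (prodErase x k.succ).eval (x k.succ) < 0 := by
  have hlt : k.castSucc < k.succ := Fin.castSucc_lt_succ
  have hxlt := hx hlt
  have h1 : k.succ ∈ Finset.univ.erase k.castSucc :=
    Finset.mem_erase.2 ⟨hlt.ne', Finset.mem_univ _⟩
  have h2 : k.castSucc ∈ Finset.univ.erase k.succ :=
    Finset.mem_erase.2 ⟨hlt.ne, Finset.mem_univ _⟩
  rw [eval_prodErase, eval_prodErase, ← Finset.mul_prod_erase _ _ h1,
    ← Finset.mul_prod_erase _ _ h2, Finset.erase_right_comm]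
  have hpos : 0 < (∏ j ∈ (Finset.univ.erase k.succ).erase k.castSucc, (x k.castSucc - x j)) *
      ∏ j ∈ (Finset.univ.erase k.succ).erase k.castSucc, (x k.succ - x j) := by
    rw [← Finset.prod_mul_distrib]
    refine Finset.prod_pos fun j hj => ?_
    simp only [Finset.mem_erase, Finset.mem_univ, and_true] at hj
    rcases lt_or_gt_of_ne hj.1 with h | h
    · have := hx h
      exact mul_pos (by linarith) (by linarith)
    · have h' : k.succ < j := lt_of_le_of_ne (Fin.castSucc_lt_iff_succ_le.1 h) hj.2.symm
      have := hx h'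
      exact mul_pos_of_neg_of_neg (by linarith) (by linarith)
  nlinarith [mul_pos (mul_pos (sub_pos.2 hxlt) (sub_pos.2 hxlt)) hpos]

/-- At a zero `c` of `p_{n+1} = (X - c) M`, the polynomial `p_n^{**}` has the sign of
`M(c) = p_{n+1}'(c)`: the reproducing property applied to `M` gives
`M(c) M(a) = K_n(c, a) ∫ M² dμ`, because `M(c) K_n(·, a) - K_n(c, a) M` vanishes at `c`. -/
theorem eval_orthPoly_iteratedChristoffel_mul_pos {μ : Measure ℝ}
    (hmom : ∀ n : ℕ, Integrable (fun x : ℝ => |x| ^ n) μ) (hsupp : μ.support.Infinite)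
    {a c : ℝ} {n : ℕ} {M : ℝ[X]} (hM : orthPoly μ (n + 1) = (X - C c) * M) (hac : a < c)
    (hMa : M.eval a ≠ 0) (hMc : M.eval c ≠ 0) :
    0 < (orthPoly (iteratedChristoffel μ a) n).eval c * M.eval c := by
  obtain ⟨hMm, hMd⟩ := degree_lt_of_orthPoly_eq_mul (monic_X_sub_C c) (by simp) hM
  have hK := kernelPoly_self_pos hmom hsupp n a
  have hMM := polyInner_self_pos hmom hsupp hMm.ne_zero
  have hkd := degree_kernelPolynomial_lt μ a (n + 1)
  have hrep := polyInner_kernelPolynomial hmom hsupp a hMd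
  have hG := congrArg (eval c) (X_sub_C_mul_orthPoly_iteratedChristoffel hmom hsupp a n)
  set k := kernelPolynomial μ a (n + 1)
  have hkey : M.eval c * M.eval a = k.eval c * polyInner μ M M := by
    have hroot : (C (M.eval c) * k - C (k.eval c) * M).IsRoot c := by
      simp [IsRoot, mul_comm]
    obtain ⟨s, hs⟩ := dvd_iff_isRoot.2 hroot
    have hsd : s.degree < ((n + 1 : ℕ) : WithBot ℕ) := by
      have hle : s.degree ≤ (C (M.eval c) * k - C (k.eval c) * M).degree := by
        rw [hs, degree_mul, degree_X_sub_C]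
        exact le_add_of_nonneg_left zero_le_one
      refine hle.trans_lt ((degree_sub_le _ _).trans_lt (max_lt ?_ ?_))
      · rw [← smul_eq_C_mul]
        exact (degree_smul_le _ _).trans_lt hkd
      · rw [← smul_eq_C_mul]
        exact (degree_smul_le _ _).trans_lt hMd
    have h0 : polyInner μ (C (M.eval c) * k - C (k.eval c) * M) M = 0 := by
      rw [hs, mul_comm, polyInner_mul_assoc, ← hM]
      exact polyInner_orthPoly_eq_zero hmom hsupp hsd
    rw [polyInner_sub_left hmom, polyInner_C_mul_left, polyInner_C_mul_left, hrep] at h0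
    linarith
  simp only [hM, eval_sub, eval_mul, eval_X, eval_C, sub_self, zero_mul, zero_sub] at hG
  have hQ : (orthPoly (iteratedChristoffel μ a) n).eval c =
      M.eval a * k.eval c / kernelPoly μ n a a := by
    refine mul_left_cancel₀ (sub_pos.2 hac).ne' ?_
    rw [hG]
    ring
  have hk : k.eval c = M.eval c * M.eval a / polyInner μ M M := by
    rw [hkey, mul_div_cancel_right₀ _ hMM.ne']
  rw [hQ, hk]
  have : M.eval a * (M.eval c * M.eval a / polyInner μ M M) / kernelPoly μ n a a * M.eval c =
      (M.eval a * M.eval c) ^ 2 / (polyInner μ M M * kernelPoly μ n a a) := by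
    field_simp
  rw [this]
  have := mul_ne_zero hMa hMc
  positivity

/-- Between consecutive zeros of `p_{n+1}` lies exactly one zero of `p_n^{**}`. -/
theorem exists_isOrderedZeros_iteratedChristoffel {μ : Measure ℝ}
    (hmom : ∀ n : ℕ, Integrable (fun x : ℝ => |x| ^ n) μ) (hsupp : μ.support.Infinite)
    {a : ℝ} {n : ℕ} {x : Fin (n + 1) → ℝ} (hx : IsOrderedZeros (n + 1) (orthPoly μ (n + 1)) x)
    (hax : ∀ k, a < x k) :
    ∃ z, IsOrderedZeros n (orthPoly (iteratedChristoffel μ a) n) z ∧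
      ∀ k : Fin n, x k.castSucc < z k ∧ z k < x k.succ := by
  obtain ⟨hm, hd⟩ := orthPoly_monic_natDegree μ (n + 1)
  obtain ⟨hQm, hQd⟩ := orthPoly_monic_natDegree (iteratedChristoffel μ a) n
  have hP : ∀ k, orthPoly μ (n + 1) = (X - C (x k)) * prodErase x k := fun k => by
    rw [X_sub_C_mul_prodErase]
    exact hm.eq_prod_X_sub_C hd hx.2.1.injective fun j => (hx.2.2 _).2 ⟨j, rfl⟩
  have hsign : ∀ k, 0 < (orthPoly (iteratedChristoffel μ a) n).eval (x k) *
      (prodErase x k).eval (x k) := fun k => by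
    refine eval_orthPoly_iteratedChristoffel_mul_pos hmom hsupp (hP k) (hax k) ?_
      (eval_prodErase_self_ne_zero hx.2.1 k)
    rw [eval_prodErase, Finset.prod_ne_zero_iff]
    exact fun j _ => (sub_neg.2 (hax j)).ne
  have hex : ∀ k : Fin n, ∃ u ∈ Set.Ioo (x k.castSucc) (x k.succ),
      (orthPoly (iteratedChristoffel μ a) n).eval u = 0 := fun k => by
    refine exists_mem_Ioo_eval_eq_zero (hx.2.1 Fin.castSucc_lt_succ) ?_
    have h := mul_pos (hsign k.castSucc) (hsign k.succ)
    rw [mul_mul_mul_comm] at h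
    exact neg_of_mul_pos_left h (eval_prodErase_castSucc_mul_succ_neg hx.2.1 k).le
  choose z hz hz0 using hex
  have hzmono : StrictMono z := fun i j hij =>
    (hz i).2.trans_le ((hx.2.1.monotone (Fin.succ_le_castSucc_iff.2 hij)).trans (hz j).1.le)
  exact ⟨z, isOrderedZeros_of_monic hQm hQd hzmono hz0, hz⟩

/-! ### The pencil `P + c G` of two polynomials with interlacing zeros -/

/-- If the zeros of `∏ (X - z_j)` and `∏ (X - x_j)` interlace, starting with `z_0`, then the two
products without their `k`-th factors have the same constant sign on `[z_k, x_k]`. -/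
theorem eval_prodErase_mul_pos {m : ℕ} {x z : Fin m → ℝ} (hzx : ∀ k, z k < x k)
    (hxz : ∀ j k, j < k → x j < z k) {k : Fin m} {s t : ℝ} (hs : s ∈ Set.Icc (z k) (x k))
    (ht : t ∈ Set.Icc (z k) (x k)) : 0 < (prodErase x k).eval s * (prodErase z k).eval t := by
  rw [eval_prodErase, eval_prodErase, ← Finset.prod_mul_distrib]
  refine Finset.prod_pos fun j hj => ?_
  rcases lt_or_gt_of_ne (Finset.ne_of_mem_erase hj) with h | h
  · have h1 := hxz j k h
    have h2 := hzx j
    exact mul_pos (by linarith [hs.1]) (by linarith [ht.1])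
  · have h1 := hxz k j h
    have h2 := hzx j
    exact mul_pos_of_neg_of_neg (by linarith [hs.2]) (by linarith [ht.2])

theorem eval_prod_mul_neg {m : ℕ} {x z : Fin m → ℝ} (hzx : ∀ k, z k < x k)
    (hxz : ∀ j k, j < k → x j < z k) {k : Fin m} {s t : ℝ} (hs : s ∈ Set.Ico (z k) (x k))
    (ht : t ∈ Set.Ioc (z k) (x k)) :
    (∏ j, (X - C (x j))).eval s * (∏ j, (X - C (z j))).eval t < 0 := by
  rw [← X_sub_C_mul_prodErase x k, ← X_sub_C_mul_prodErase z k]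
  simp only [eval_mul, eval_sub, eval_X, eval_C]
  have h := eval_prodErase_mul_pos hzx hxz (Set.Ico_subset_Icc_self hs)
    (Set.Ioc_subset_Icc_self ht)
  nlinarith [mul_pos (mul_pos (sub_pos.2 hs.2) (sub_pos.2 ht.1)) h]

/-- Raising the parameter `c` moves a zero of `P + c G` in `(z_k, x_k]` to the left. -/
theorem exists_pencil_zero {m : ℕ} {x z : Fin m → ℝ} (hzx : ∀ k, z k < x k)
    (hxz : ∀ j k, j < k → x j < z k) {P G : ℝ[X]} (hP : P = ∏ j, (X - C (x j)))
    (hG : G = ∏ j, (X - C (z j))) {c d : ℝ} (hcd : c < d) {k : Fin m} {y : ℝ}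
    (hy : y ∈ Set.Ioc (z k) (x k)) (hy0 : P.eval y + c * G.eval y = 0) :
    ∃ u ∈ Set.Ioo (z k) y, P.eval u + d * G.eval u = 0 := by
  have hneg := eval_prod_mul_neg hzx hxz (Set.left_mem_Ico.2 (hzx k)) hy
  rw [← hP, ← hG] at hneg
  have hGz : G.eval (z k) = 0 := by
    rw [hG, ← X_sub_C_mul_prodErase z k]
    simp
  have h : (P + C d * G).eval (z k) * (P + C d * G).eval y < 0 := by
    simp only [eval_add, eval_mul, eval_C, hGz]
    have : P.eval y + d * G.eval y = (d - c) * G.eval y := by linarith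
    rw [this]
    nlinarith [mul_pos (sub_pos.2 hcd) (neg_pos.2 hneg)]
  obtain ⟨u, hu, hu0⟩ := exists_mem_Ioo_eval_eq_zero hy.1 h
  exact ⟨u, hu, by simpa using hu0⟩

theorem exists_pencil_zeros {m : ℕ} {x z : Fin m → ℝ} (hzx : ∀ k, z k < x k)
    (hxz : ∀ j k, j < k → x j < z k) {P G : ℝ[X]} (hP : P = ∏ j, (X - C (x j)))
    (hG : G = ∏ j, (X - C (z j))) {c : ℝ} (hc : 0 ≤ c) :
    ∃ y : Fin m → ℝ, (∀ k, y k ∈ Set.Ioc (z k) (x k)) ∧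
      (∀ k, P.eval (y k) + c * G.eval (y k) = 0) ∧ (0 < c → ∀ k, y k < x k) := by
  have hPx : ∀ k, P.eval (x k) + 0 * G.eval (x k) = 0 := fun k => by
    rw [hP, ← X_sub_C_mul_prodErase x k]
    simp
  rcases hc.eq_or_lt with rfl | hc
  · exact ⟨x, fun k => Set.right_mem_Ioc.2 (hzx k), hPx, fun h => absurd h (lt_irrefl _)⟩
  · choose y hy hy0 using fun k =>
      exists_pencil_zero hzx hxz hP hG hc (Set.right_mem_Ioc.2 (hzx k)) (hPx k)
    exact ⟨y, fun k => ⟨(hy k).1, (hy k).2.le⟩, hy0, fun _ k => (hy k).2⟩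

theorem strictMono_of_mem_Ioc {m : ℕ} {x z y : Fin m → ℝ} (hxz : ∀ j k, j < k → x j < z k)
    (hy : ∀ k, y k ∈ Set.Ioc (z k) (x k)) : StrictMono y := fun j k hjk =>
  (hy j).2.trans_lt ((hxz j k hjk).trans (hy k).1)

/-- The intervals `(z_k, x_k]` are disjoint. -/
theorem eq_of_mem_Ioc_of_mem_Ioc {m : ℕ} {x z : Fin m → ℝ} (hxz : ∀ j k, j < k → x j < z k)
    {j k : Fin m} {t : ℝ} (hj : t ∈ Set.Ioc (z j) (x j)) (hk : t ∈ Set.Ioc (z k) (x k)) :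
    j = k := by
  rcases lt_trichotomy j k with h | h | h
  · exact absurd (hxz j k h) (not_lt.2 (hk.1.le.trans hj.2))
  · exact h
  · exact absurd (hxz k j h) (not_lt.2 (hj.1.le.trans hk.2))

/-- A zero of `P + N K G`, `G = (X - z) B`, confined to `(z, w]` satisfies
`N (y - z) = -P(y) / (K B(y))`. The right-hand side is bounded, so that `y → z` as `N → ∞`, and
then it converges to `-P(z) / (K G'(z))`. -/
theorem tendsto_pencil_zero {P B : ℝ[X]} {z w K : ℝ} (hK : 0 < K)
    (hB : ∀ t ∈ Set.Icc z w, B.eval t ≠ 0) {y : ℝ → ℝ}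
    (hy : ∀ N, 0 < N → y N ∈ Set.Ioc z w)
    (hy0 : ∀ N, 0 < N → P.eval (y N) + N * K * ((X - C z) * B).eval (y N) = 0) :
    Filter.Tendsto y Filter.atTop (nhds z) ∧
      Filter.Tendsto (fun N => N * (y N - z)) Filter.atTop
        (nhds (-P.eval z / (K * ((X - C z) * B).derivative.eval z))) := by
  have hzw : z ≤ w := ((hy 1 one_pos).1.le.trans (hy 1 one_pos).2)
  have hcont : ContinuousOn (fun t => -P.eval t / (K * B.eval t)) (Set.Icc z w) :=
    P.continuous.neg.continuousOn.div (continuous_const.mul B.continuous).continuousOn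
      fun t ht => mul_ne_zero hK.ne' (hB t ht)
  have heq : ∀ N, 0 < N → N * (y N - z) = -P.eval (y N) / (K * B.eval (y N)) := fun N hN => by
    have hBN := hB _ (Set.Ioc_subset_Icc_self (hy N hN))
    rw [eq_div_iff (mul_ne_zero hK.ne' hBN)]
    have := hy0 N hN
    simp only [eval_mul, eval_sub, eval_X, eval_C] at this
    linarith
  obtain ⟨b, hb⟩ := isCompact_Icc.exists_bound_of_continuousOn hcont
  have hlim : Filter.Tendsto y Filter.atTop (nhds z) := by
    have hup : Filter.Tendsto (fun N : ℝ => z + b / N) Filter.atTop (nhds z) := by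
      simpa using (Filter.tendsto_id.const_div_atTop b).const_add z
    refine tendsto_of_tendsto_of_tendsto_of_le_of_le' tendsto_const_nhds hup ?_ ?_
    · filter_upwards [Filter.eventually_gt_atTop 0] with N hN using (hy N hN).1.le
    · filter_upwards [Filter.eventually_gt_atTop 0] with N hN
      have h1 := hb _ (Set.Ioc_subset_Icc_self (hy N hN))
      rw [Real.norm_eq_abs, ← heq N hN] at h1
      have h2 : y N - z ≤ b / N := by
        rw [le_div_iff₀ hN, mul_comm]
        exact (le_abs_self _).trans h1
      linarith
  refine ⟨hlim, ?_⟩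
  have hval : -P.eval z / (K * ((X - C z) * B).derivative.eval z) =
      -P.eval z / (K * B.eval z) := by
    simp [derivative_mul]
  rw [hval]
  have hlim' : Filter.Tendsto y Filter.atTop (nhdsWithin z (Set.Icc z w)) := by
    refine tendsto_nhdsWithin_iff.2 ⟨hlim, ?_⟩
    filter_upwards [Filter.eventually_gt_atTop 0] with N hN using
      Set.Ioc_subset_Icc_self (hy N hN)
  refine ((hcont z (Set.left_mem_Icc.2 hzw)).tendsto.comp hlim').congr' ?_
  filter_upwards [Filter.eventually_gt_atTop 0] with N hN using (heq N hN).symm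

/-! ### The zeros of the polynomials of the Uvarov transform -/

theorem eval_orthPoly_uvarov_eq_zero_iff {μ : Measure ℝ}
    (hmom : ∀ n : ℕ, Integrable (fun x : ℝ => |x| ^ n) μ) (hsupp : μ.support.Infinite)
    (a : ℝ) (n : ℕ) {N : ℝ} (hN : 0 ≤ N) (t : ℝ) :
    (orthPoly (uvarov μ a N) (n + 1)).eval t = 0 ↔ (orthPoly μ (n + 1)).eval t +
      N * kernelPoly μ n a a *
        ((X - C a) * orthPoly (iteratedChristoffel μ a) n).eval t = 0 := by
  have h := congrArg (eval t) (C_mul_orthPoly_uvarov hmom hsupp a n hN)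
  have hK := kernelPoly_self_pos hmom hsupp n a
  have hpos : 1 + N * kernelPoly μ n a a ≠ 0 := by positivity
  rw [eval_mul, eval_C, eval_add, eval_mul (p := C _), eval_C] at h
  rw [← h, mul_eq_zero, or_iff_right hpos]

theorem ae_le_of_convexHull_support {μ : Measure ℝ} {ξ : ℝ} {η : EReal}
    (hhull : convexHull ℝ μ.support = {t : ℝ | ξ ≤ t ∧ (t : EReal) ≤ η}) : ∀ᵐ x ∂μ, ξ ≤ x := by
  filter_upwards [Measure.support_mem_ae (μ := μ)] with x hx
  have := subset_convexHull ℝ _ hx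
  rw [hhull] at this
  exact this.1

theorem theorem3 (μ : MeasureTheory.Measure ℝ)
    (hmom : ∀ m : ℕ, MeasureTheory.Integrable (fun x : ℝ => |x| ^ m) μ)
    (hsupp : μ.support.Infinite)
    (ξ : ℝ) (η : EReal)
    (hhull : convexHull ℝ μ.support = {t : ℝ | ξ ≤ t ∧ (t : EReal) ≤ η})
    (a : ℝ) (ha : a ≤ ξ) (n : ℕ) :
    ∃ (x : Fin (n + 1) → ℝ) (xss : Fin n → ℝ) (xN : ℝ → Fin (n + 1) → ℝ),
      -- `x`, `xss`, `xN N` are the zeros of the polynomials of degrees `n + 1`, `n`, `n + 1`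
      IsOrderedZeros (n + 1) (orthPoly μ (n + 1)) x ∧
      IsOrderedZeros n (orthPoly (iteratedChristoffel μ a) n) xss ∧
      (∀ N : ℝ, 0 ≤ N → IsOrderedZeros (n + 1) (orthPoly (uvarov μ a N) (n + 1)) (xN N)) ∧
      -- interlacing
      (∀ N : ℝ, 0 < N →
        a < xN N 0 ∧
        (∀ k : Fin (n + 1), xN N k < x k) ∧
        (∀ k : Fin n, x k.castSucc < xss k ∧ xss k < xN N k.succ)) ∧
      -- monotonicity
      (∀ k : Fin (n + 1), StrictAntiOn (fun N : ℝ => xN N k) (Set.Ici 0)) ∧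
      -- limits
      Filter.Tendsto (fun N : ℝ => xN N 0) Filter.atTop (nhds a) ∧
      (∀ k : Fin n, Filter.Tendsto (fun N : ℝ => xN N k.succ) Filter.atTop (nhds (xss k))) ∧
      -- speed of convergence
      Filter.Tendsto (fun N : ℝ => N * (xN N 0 - a)) Filter.atTop
        (nhds (-(orthPoly μ (n + 1)).eval a /
          (kernelPoly μ n a a * (orthPoly (iteratedChristoffel μ a) n).eval a))) ∧
      (∀ k : Fin n, Filter.Tendsto (fun N : ℝ => N * (xN N k.succ - xss k)) Filter.atTop
        (nhds (-(orthPoly μ (n + 1)).eval (xss k) /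
          (kernelPoly μ n a a * (xss k - a) *
            (orthPoly (iteratedChristoffel μ a) n).derivative.eval (xss k))))) := by
  have hae : ∀ᵐ t ∂μ, a ≤ t := (ae_le_of_convexHull_support hhull).mono fun t ht => ha.trans ht
  obtain ⟨x, hx⟩ := exists_isOrderedZeros_orthPoly hmom hsupp (n + 1)
  have hax : ∀ k, a < x k := fun k =>
    lt_of_isRoot_orthPoly hmom hsupp hae ((hx.2.2 _).2 ⟨k, rfl⟩)
  obtain ⟨xss, hxss, hint⟩ := exists_isOrderedZeros_iteratedChristoffel hmom hsupp hx hax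
  have hRz := @eval_orthPoly_uvarov_eq_zero_iff μ hmom hsupp a n
  have hK := kernelPoly_self_pos hmom hsupp n a
  obtain ⟨hPm, hPd⟩ := orthPoly_monic_natDegree μ (n + 1)
  obtain ⟨hQm, hQd⟩ := orthPoly_monic_natDegree (iteratedChristoffel μ a) n
  set P := orthPoly μ (n + 1)
  set Q := orthPoly (iteratedChristoffel μ a) n
  set K := kernelPoly μ n a a
  -- The zeros of `(X - a) p_n^{**}`, in increasing order.
  set z : Fin (n + 1) → ℝ := Fin.cons a xss with hz
  have hzx : ∀ k, z k < x k := by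
    refine Fin.cases (hax 0) fun k => ?_
    simpa [hz] using (hint k).2
  have hxz : ∀ j k, j < k → x j < z k := by
    intro j k
    refine Fin.cases (fun h => absurd h (Fin.not_lt_zero j)) (fun k h => ?_) k
    rw [hz, Fin.cons_succ]
    exact (hx.2.1.monotone (Fin.le_castSucc_iff.2 h)).trans_lt (hint k).1
  have hP : P = ∏ j, (X - C (x j)) :=
    hPm.eq_prod_X_sub_C hPd hx.2.1.injective fun j => (hx.2.2 _).2 ⟨j, rfl⟩
  have hG : (X - C a) * Q = ∏ j, (X - C (z j)) := by
    rw [Fin.prod_univ_succ, hQm.eq_prod_X_sub_C hQd hxss.2.1.injective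
      fun j => (hxss.2.2 _).2 ⟨j, rfl⟩]
    simp [hz]
  choose! Y hYmem hY0 hYlt using fun (c : ℝ) (hc : 0 ≤ c) => exists_pencil_zeros hzx hxz hP hG hc
  have hNK : ∀ {N : ℝ}, 0 ≤ N → 0 ≤ N * K := fun hN => mul_nonneg hN hK.le
  have hzeros : ∀ N : ℝ, 0 ≤ N →
      IsOrderedZeros (n + 1) (orthPoly (uvarov μ a N) (n + 1)) (Y (N * K)) := fun N hN =>
    isOrderedZeros_of_monic (orthPoly_monic_natDegree _ _).1 (orthPoly_monic_natDegree _ _).2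
      (strictMono_of_mem_Ioc hxz (hYmem _ (hNK hN)))
      fun k => (hRz hN _).2 (hY0 _ (hNK hN) k)
  have hlim := fun k => tendsto_pencil_zero (P := P) (B := prodErase z k) (z := z k) (w := x k)
    (y := fun N => Y (N * K) k) hK
    (fun t ht => right_ne_zero_of_mul (eval_prodErase_mul_pos hzx hxz ht ht).ne')
    (fun N hN => hYmem _ (hNK hN.le) k)
    (fun N hN => by
      rw [X_sub_C_mul_prodErase, ← hG]
      exact hY0 _ (hNK hN.le) k)
  simp only [X_sub_C_mul_prodErase, ← hG] at hlim
  refine ⟨x, xss, fun N => Y (N * K), hx, hxss, hzeros, fun N hN => ⟨?_, ?_, fun k => ?_⟩,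
    fun k N₁ hN₁ N₂ hN₂ h12 => ?_, (hlim 0).1, fun k => (hlim k.succ).1, ?_, fun k => ?_⟩
  · exact (hYmem _ (hNK hN.le) 0).1
  · exact hYlt _ (hNK hN.le) (mul_pos hN hK)
  · exact ⟨(hint k).1, (hYmem _ (hNK hN.le) k.succ).1⟩
  · have hmem := hYmem _ (hNK hN₁) k
    obtain ⟨u, hu, hu0⟩ := exists_pencil_zero hzx hxz hP hG (mul_lt_mul_of_pos_right h12 hK)
      hmem (hY0 _ (hNK hN₁) k)
    -- The zero `u` is the one with index `k`, since it lies in `(z k, x k]`.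
    obtain ⟨j, hj⟩ := ((hzeros N₂ hN₂).2.2 u).1 ((hRz hN₂ u).2 hu0)
    have hjk : j = k := eq_of_mem_Ioc_of_mem_Ioc hxz (hj ▸ hYmem _ (hNK hN₂) j)
      ⟨hu.1, hu.2.le.trans hmem.2⟩
    subst hjk
    exact hj.trans_lt hu.2
  · have h := (hlim 0).2
    simpa [hz, derivative_mul] using h
  · have h := (hlim k.succ).2
    have hQk : Q.eval (xss k) = 0 := (hxss.2.2 _).2 ⟨k, rfl⟩
    simpa [hz, derivative_mul, hQk, mul_assoc] using h
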